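/- Let $R$ be a left coherent ring (associative with identity, not necessarily commutative), i.e. every finitely generated left ideal of $R$ is finitely presented. A left $R$-module $M$ is FP-injective if $\operatorname{Ext}^1_R(F,M)=0$ for every finitely presented left $R$-module $F$. A chain complex $W$ of left $R$-modules ($\mathbb{Z}$-indexed, unbounded) is coacyclic if every chain map $W\to I$ to a complex $I$ of injective left $R$-modules is null homotopic. An exact complex $X$ is pure exact if for every $n\in\mathbb{Z}$ and every finitely presented left $R$-module $F$, the map $\operatorname{Hom}_R(F,X_{n+1})\to\operatorname{Hom}_R(F,Z_nX)$ induced by the differential is surjective, where $Z_nX$ is the module of $n$-cycles. Then for every chain complex $X$ of left $R$-modules the following are equivalent: (1) $X$ is exact and every cycle module $Z_nX$ is FP-injective; (2) $X$ is coacyclic and every $X_n$ is FP-injective; (3) $X$ is pure exact and every $X_n$ is FP-injective. -/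

import Mathlib

open CategoryTheory

universe u

/-- `R` is left coherent: every finitely generated left ideal is finitely presented. (`Ideal R` is
the type of left ideals of the possibly noncommutative ring `R`.) -/
def IsLeftCoherent (R : Type u) [Ring R] : Prop :=
  ∀ I : Ideal R, I.FG → Module.FinitePresentation R I

/-- `M` is FP-injective (absolutely pure): `Ext¹(F, M) = 0` for all finitely presented `F`. -/
def IsFPInjective {R : Type u} [Ring R] (M : ModuleCat.{u} R) : Prop :=
  ∀ F : ModuleCat.{u} R, Module.FinitePresentation R F →
    Subsingleton (Abelian.Ext.{u} F M 1)

/-- `f` is a pure epimorphism: `Hom(F, f)` is surjective for all finitely presented `F`. (Taking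
`F = R` shows that `f` is surjective.) -/
def IsPureEpi {R : Type u} [Ring R] {A B : ModuleCat.{u} R} (f : A ⟶ B) : Prop :=
  ∀ F : ModuleCat.{u} R, Module.FinitePresentation R F →
    ∀ t : F ⟶ B, ∃ s : F ⟶ A, s ≫ f = t

/-- Complexes with FP-injective components. -/
def IsDegreewiseFPInjective {R : Type u} [Ring R]
    (X : ChainComplex (ModuleCat.{u} R) ℤ) : Prop :=
  ∀ n : ℤ, IsFPInjective (X.X n)

/-- Complexes with injective components. -/
def IsDegreewiseInjective {R : Type u} [Ring R]
    (X : ChainComplex (ModuleCat.{u} R) ℤ) : Prop :=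
  ∀ n : ℤ, Injective (X.X n)

/-- Exact complexes all of whose cycle modules are FP-injective. -/
def IsExactWithFPInjectiveCycles {R : Type u} [Ring R]
    (X : ChainComplex (ModuleCat.{u} R) ℤ) : Prop :=
  X.Acyclic ∧ ∀ n : ℤ, IsFPInjective (X.cycles n)

/-- Coacyclic complexes (in the sense of Becker): every chain map to a complex of injectives is
null homotopic. -/
def IsCoacyclic {R : Type u} [Ring R] (W : ChainComplex (ModuleCat.{u} R) ℤ) : Prop :=
  ∀ I : ChainComplex (ModuleCat.{u} R) ℤ, IsDegreewiseInjective I →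
    ∀ f : W ⟶ I, Nonempty (Homotopy f 0)

/-- Pure exact complexes: exact complexes such that each short exact sequence
`0 ⟶ Z_{n+1} X ⟶ X_{n+1} ⟶ Z_n X ⟶ 0` is pure exact. -/
def IsPureExact {R : Type u} [Ring R] (X : ChainComplex (ModuleCat.{u} R) ℤ) : Prop :=
  X.Acyclic ∧ ∀ n : ℤ, IsPureEpi (X.toCycles (n + 1) n)

/-!
All conditions are compared with the exactness of the complexes of abelian groups `Hom(F, X)`, for
finitely presented `F` (`IsFPHomExact`). For any complex this is pure exactness
(`isPureExact_iff`), and for any ring it amounts, on complexes with FP-injective components, to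
exactness with FP-injective cycles (`isExactWithFPInjectiveCycles_iff`): a submodule is pure if it
is FP-injective, pure submodules of FP-injective modules are FP-injective, and so are extensions of
FP-injective modules. Coherence enters in the comparison with coacyclicity, which rests on two
facts about a degreewise FP-injective complex `X`.

*Embedding in injectives* (`IsLeftCoherent.exists_isFPAcyclicExtension`). There is a monomorphism
`i : X ⟶ Y` to a complex of injectives with cokernel a transfinite extension of disk complexes
on FP-injective modules. Since disks are contractible, `Hom(F, -)` is exact on the cokernel for
finitely presented `F`, so `Hom(F, X)` is exact if and only if `Hom(F, Y)` is. The complex `Y`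
comes from the small object argument for a set of maps of disks. A set suffices because an
FP-injective module `M` is injective as soon as `Ext¹(N, M) = 0` for a set of FP-injective modules
`N` (`IsLeftCoherent.injective_of_hasTermExtensions`): each element of an FP-injective module lies
in an FP-injective submodule generated by iterated solutions of finite linear systems, of
cardinality bounded in terms of `R`. This uses that over a coherent ring FP-injective modules are
closed under cokernels of monomorphisms; the components of `Y` are FP-injective because the closure
under filtered colimits, too, holds over a coherent ring.

*Contractibility* (`IsLeftCoherent.nonempty_contraction`). If `Y` is a complex of injectives and
`Hom(F, Y)` is exact for finitely presented `F`, then `Y` is contractible. The complex `Hom(I, Y)`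
is exact for every left ideal `I`, by transfinite induction on the number of generators of `I`:
finitely generated left ideals are finitely presented, and solutions extend along a well-ordered
chain of left ideals because `Y` is degreewise injective. Then the cycles of `Y` are injective by
Baer's criterion, and `Y` splits.

If `Hom(F, X)` is exact for all finitely presented `F`, then `Y` is contractible; every morphism
from `X` to a complex of injectives extends to `Y` by the left lifting property of `i`, hence is
null homotopic. Conversely, if `X` is coacyclic, then `i` is null homotopic, so it lifts to the
path object of `Y`; the lifting property extends the lift to a section on `Y`, which is a
contraction of `Y` (`nonempty_contraction_of_llp`). Hence `Hom(F, Y)` is exact, and so is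
`Hom(F, X)`.
-/

open Limits Abelian

/-! ### FP-injective modules -/

section FPInjectiveModules

variable {R : Type u} [Ring R]

/-- The short complex `K ⟶ M ⟶ M ⧸ K`. -/
abbrev quotientShortComplex {M : Type u} [AddCommGroup M] [Module R M] (K : Submodule R M) :
    ShortComplex (ModuleCat.{u} R) :=
  ShortComplex.mk (ModuleCat.ofHom K.subtype) (ModuleCat.ofHom K.mkQ) (by ext; simp)

lemma quotientShortComplex_shortExact {M : Type u} [AddCommGroup M] [Module R M]
    (K : Submodule R M) : (quotientShortComplex K).ShortExact where
  exact := by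
    rw [ShortComplex.moduleCat_exact_iff]
    intro x hx
    exact ⟨⟨x, by simpa using hx⟩, rfl⟩
  mono_f := (ModuleCat.mono_iff_injective _).2 K.subtype_injective
  epi_g := (ModuleCat.epi_iff_surjective _).2 K.mkQ_surjective

lemma IsFPInjective.of_iso {M N : ModuleCat.{u} R} (e : M ≅ N) (hM : IsFPInjective M) :
    IsFPInjective N := by
  intro F hF
  have := hM F hF
  refine Function.Injective.subsingleton
    (f := fun x : Ext.{u} F N 1 ↦ x.comp (Ext.mk₀ e.inv) (add_zero 1)) fun x y h ↦ ?_
  have h' := congr_arg (fun z ↦ z.comp (Ext.mk₀ e.hom) (add_zero 1)) h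
  simpa using h'

lemma IsFPInjective.of_injective {M : ModuleCat.{u} R} (hM : Injective M) : IsFPInjective M :=
  fun F _ ↦ Ext.subsingleton_of_injective F M 0

/-- Morphisms from finitely presented modules lift along epimorphisms with FP-injective kernel. -/
lemma IsFPInjective.exists_lift {S : ShortComplex (ModuleCat.{u} R)} (hS : S.ShortExact)
    (h₁ : IsFPInjective S.X₁) {F : ModuleCat.{u} R} (hF : Module.FinitePresentation R F)
    (g : F ⟶ S.X₃) : ∃ h : F ⟶ S.X₂, h ≫ S.g = g := by
  have := h₁ F hF
  obtain ⟨x, hx⟩ := Ext.covariant_sequence_exact₃ F hS (Ext.mk₀ g) (zero_add 1)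
    (Subsingleton.elim _ _)
  obtain ⟨h, rfl⟩ := (Ext.mk₀_bijective _ _).2 x
  exact ⟨h, (Ext.mk₀_bijective _ _).1 (by simpa using hx)⟩

lemma IsFPInjective.of_shortExact_middle {S : ShortComplex (ModuleCat.{u} R)}
    (hS : S.ShortExact) (h₁ : IsFPInjective S.X₁) (h₃ : IsFPInjective S.X₃) :
    IsFPInjective S.X₂ := by
  intro F hF
  have := h₁ F hF
  have := h₃ F hF
  refine subsingleton_of_forall_eq 0 fun x ↦ ?_
  obtain ⟨y, rfl⟩ := Ext.covariant_sequence_exact₂ F hS x (Subsingleton.elim _ _)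
  simp [Subsingleton.elim y 0]

/-- A pure submodule of an FP-injective module is FP-injective. -/
lemma IsFPInjective.of_isPureEpi {S : ShortComplex (ModuleCat.{u} R)}
    (hS : S.ShortExact) (h₂ : IsFPInjective S.X₂) (hg : IsPureEpi S.g) :
    IsFPInjective S.X₁ := by
  intro F hF
  have := h₂ F hF
  refine subsingleton_of_forall_eq 0 fun x ↦ ?_
  obtain ⟨y, rfl⟩ := Ext.covariant_sequence_exact₁ F hS x (Subsingleton.elim _ _) (zero_add 1)
  obtain ⟨t, rfl⟩ := (Ext.mk₀_bijective _ _).2 y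
  obtain ⟨s, rfl⟩ := hg F hF t
  rw [← Ext.mk₀_comp_mk₀, Ext.comp_assoc_of_second_deg_zero]
  simp

/-- FP-injectivity is an extension property for finitely generated submodules of finite free
modules. -/
lemma isFPInjective_iff_exists_extension {M : ModuleCat.{u} R} :
    IsFPInjective M ↔ ∀ (n : ℕ) (K : Submodule R (Fin n → R)), K.FG → ∀ φ : K →ₗ[R] M,
      ∃ ψ : (Fin n → R) →ₗ[R] M, ∀ x : K, ψ x = φ x := by
  constructor
  · intro hM n K hK φ
    have hF : Module.FinitePresentation R ((Fin n → R) ⧸ K) :=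
      Module.finitePresentation_of_surjective K.mkQ K.mkQ_surjective (by simpa using hK)
    have := hM (ModuleCat.of R ((Fin n → R) ⧸ K)) hF
    obtain ⟨y, hy⟩ := Ext.contravariant_sequence_exact₁ (quotientShortComplex_shortExact K) M
      (Ext.mk₀ (ModuleCat.ofHom φ)) (add_zero 1) (Subsingleton.elim _ _)
    obtain ⟨ψ, rfl⟩ := (Ext.mk₀_bijective _ _).2 y
    rw [Ext.mk₀_comp_mk₀] at hy
    have h := (Ext.mk₀_bijective _ _).1 hy
    exact ⟨ψ.hom, fun x ↦ congr($h x)⟩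
  · intro hM F hF
    obtain ⟨n, K, e, hK⟩ := Module.FinitePresentation.exists_fin R F
    suffices Subsingleton (Ext.{u} (ModuleCat.of R ((Fin n → R) ⧸ K)) M 1) by
      refine Function.Injective.subsingleton
        (f := fun x : Ext.{u} F M 1 ↦ (Ext.mk₀ e.toModuleIso.inv).comp x (zero_add 1))
        fun x y h ↦ ?_
      have h' := congr_arg (fun z ↦ (Ext.mk₀ e.toModuleIso.hom).comp z (zero_add 1)) h
      simpa [-LinearEquiv.toModuleIso_hom, -LinearEquiv.toModuleIso_inv] using h'
    have : Projective (ModuleCat.of R (Fin n → R)) := ModuleCat.projective_of_free (Pi.basisFun R _)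
    have := Ext.subsingleton_of_projective (ModuleCat.of R (Fin n → R)) M 0
    have hS := quotientShortComplex_shortExact K
    refine subsingleton_of_forall_eq 0 fun x ↦ ?_
    obtain ⟨y, rfl⟩ := Ext.contravariant_sequence_exact₃ hS M x (Subsingleton.elim _ _)
      (add_zero 1)
    obtain ⟨φ, rfl⟩ := (Ext.mk₀_bijective _ _).2 y
    obtain ⟨ψ, hψ⟩ := hM n K hK φ.hom
    obtain rfl : (quotientShortComplex K).f ≫ ModuleCat.ofHom ψ = φ := by
      ext x
      exact hψ x
    rw [← Ext.mk₀_comp_mk₀]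
    exact hS.extClass_comp_assoc _

/-- Finitely generated submodules of finite free modules over a left coherent ring are finitely
presented, by induction on the rank: project to the first coordinate. -/
lemma IsLeftCoherent.finitePresentation_of_fg (hR : IsLeftCoherent R) {n : ℕ}
    (K : Submodule R (Fin n → R)) (hK : K.FG) : Module.FinitePresentation R K := by
  induction n with
  | zero =>
    have : Subsingleton K := inferInstance
    have : Module.Finite R K := Module.Finite.iff_fg.2 hK
    exact Module.finitePresentation_of_projective _ _
  | succ n ih =>
    have : Module.Finite R K := Module.Finite.iff_fg.2 hK
    let p : K →ₗ[R] R := (LinearMap.proj 0).comp K.subtype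
    let t : (Fin (n + 1) → R) →ₗ[R] (Fin n → R) := LinearMap.funLeft R R Fin.succ
    have hI : Module.FinitePresentation R (LinearMap.range p) :=
      hR _ (Submodule.FG.of_finite)
    have hker : (LinearMap.ker p.rangeRestrict).FG :=
      Module.FinitePresentation.fg_ker _ p.surjective_rangeRestrict
    have hinj : Function.Injective
        ((t.comp K.subtype).comp (LinearMap.ker p.rangeRestrict).subtype) := by
      rw [injective_iff_map_eq_zero]
      rintro ⟨x, hx⟩ h
      have hx' : p x = 0 := by simpa using hx
      ext i
      induction i using Fin.cases with
      | zero => exact hx'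
      | succ i => exact congr_fun h i
    have : Module.Finite R (LinearMap.ker p.rangeRestrict) := Module.Finite.iff_fg.2 hker
    have hfp := ih (LinearMap.range
      ((t.comp K.subtype).comp (LinearMap.ker p.rangeRestrict).subtype)) Submodule.FG.of_finite
    let e := (LinearEquiv.ofInjective _ hinj).symm
    have : Module.FinitePresentation R (LinearMap.ker p.rangeRestrict) :=
      Module.finitePresentation_of_surjective (N := LinearMap.ker p.rangeRestrict)
        e.toLinearMap e.surjective (by rw [LinearEquiv.ker]; exact Submodule.fg_bot)
    exact Module.finitePresentation_of_ker p.rangeRestrict p.surjective_rangeRestrict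

/-- Over a left coherent ring, quotients of FP-injective modules by FP-injective submodules are
FP-injective. -/
lemma IsLeftCoherent.isFPInjective_of_shortExact (hR : IsLeftCoherent R)
    {S : ShortComplex (ModuleCat.{u} R)} (hS : S.ShortExact)
    (h₁ : IsFPInjective S.X₁) (h₂ : IsFPInjective S.X₂) : IsFPInjective S.X₃ := by
  rw [isFPInjective_iff_exists_extension]
  intro n K hK φ
  obtain ⟨l, hl⟩ := h₁.exists_lift hS (F := ModuleCat.of R K) (hR.finitePresentation_of_fg K hK)
    (ModuleCat.ofHom φ)
  obtain ⟨ψ, hψ⟩ := isFPInjective_iff_exists_extension.1 h₂ n K hK l.hom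
  refine ⟨S.g.hom.comp ψ, fun x ↦ ?_⟩
  simpa [hψ] using congr($hl x)

end FPInjectiveModules

/-! ### A set of test modules for injectivity -/

section SolutionTerms

/-- Terms built from one generator `gen` by the module operations and by symbols `sol a t i` for
the `i`-th entry of a chosen solution of the linear system with coefficients `a` and right-hand
sides `t`. They form a type in the universe of `R`. -/
inductive SolutionTerm (R : Type u) : Type u
  | gen : SolutionTerm R
  | add (s t : SolutionTerm R) : SolutionTerm R
  | smul (r : R) (t : SolutionTerm R) : SolutionTerm R
  | sol {k n : ℕ} (a : Fin k → Fin n → R) (t : Fin k → SolutionTerm R) (i : Fin n) :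
      SolutionTerm R

variable {R : Type u} [Ring R] {M : Type u} [AddCommGroup M] [Module R M]

open Classical in
/-- The value of a term in `M` when the generator is sent to `e`. A system without solutions is
given the value `0`. -/
noncomputable def SolutionTerm.eval (e : M) : SolutionTerm R → M
  | gen => e
  | add s t => s.eval e + t.eval e
  | smul r t => r • t.eval e
  | sol a t i =>
    if h : ∃ x : Fin _ → M, ∀ j, ∑ i, a j i • x i = (t j).eval e then h.choose i else 0

/-- The submodule of all values of terms at `e`. -/
def solutionClosure (e : M) : Submodule R M where
  carrier := Set.range (SolutionTerm.eval (R := R) e)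
  add_mem' := by
    rintro _ _ ⟨s, rfl⟩ ⟨t, rfl⟩
    exact ⟨.add s t, by rw [SolutionTerm.eval]⟩
  zero_mem' := ⟨.smul 0 .gen, by rw [SolutionTerm.eval, zero_smul]⟩
  smul_mem' := by
    rintro r _ ⟨t, rfl⟩
    exact ⟨.smul r t, by rw [SolutionTerm.eval]⟩

lemma exists_solution_mem_solutionClosure (e : M) {k n : ℕ} (a : Fin k → Fin n → R)
    (y : Fin k → solutionClosure (R := R) e) (x : Fin n → M)
    (hx : ∀ j, ∑ i, a j i • x i = y j) :
    ∃ x' : Fin n → solutionClosure (R := R) e, ∀ j, ∑ i, a j i • x' i = y j := by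
  choose t ht using fun j ↦ (y j).2
  have h : ∃ x : Fin n → M, ∀ j, ∑ i, a j i • x i = (t j).eval e := ⟨x, by simpa [ht] using hx⟩
  refine ⟨fun i ↦ ⟨_, .sol a t i, rfl⟩, fun j ↦ Subtype.ext ?_⟩
  have := h.choose_spec j
  simp only [Submodule.coe_sum, Submodule.coe_smul, SolutionTerm.eval, dif_pos h]
  rw [this, ht]

lemma isFPInjective_solutionClosure (hM : IsFPInjective (ModuleCat.of R M)) (e : M) :
    IsFPInjective (ModuleCat.of R (solutionClosure (R := R) e)) := by
  rw [isFPInjective_iff_exists_extension] at hM ⊢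
  intro n K hK φ
  obtain ⟨k, s, hs⟩ := Submodule.fg_iff_exists_fin_generating_family.1 hK
  have hsK (j : Fin k) : s j ∈ K := hs ▸ Submodule.subset_span ⟨j, rfl⟩
  obtain ⟨ψ, hψ⟩ := hM n K hK ((solutionClosure (R := R) e).subtype.comp φ)
  obtain ⟨x, hx⟩ := exists_solution_mem_solutionClosure e s (fun j ↦ φ ⟨s j, hsK j⟩)
    (fun i ↦ ψ (Pi.single i 1)) (fun j ↦ by
      refine Eq.trans ?_ (hψ ⟨s j, hsK j⟩)
      simp_rw [← map_smul, ← map_sum]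
      congr 1
      ext i
      simp [Finset.sum_apply, Pi.single_apply])
  suffices ∀ y (hy : y ∈ K), Fintype.linearCombination R x y = φ ⟨y, hy⟩ from
    ⟨Fintype.linearCombination R x, fun y ↦ this y y.2⟩
  subst hs
  intro y hy
  induction hy using Submodule.span_induction with
  | mem y hy =>
    obtain ⟨j, rfl⟩ := hy
    exact hx j
  | zero => rw [map_zero]; exact (map_zero φ).symm
  | add y z hy hz hy' hz' => rw [map_add, hy', hz', ← map_add]; rfl
  | smul r y hy hy' => rw [map_smul, hy', ← map_smul]; rfl

/-- The extension property of `M` with respect to all inclusions into the free module on the set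
of terms that have an FP-injective cokernel. -/
def HasTermExtensions (M : ModuleCat.{u} R) : Prop :=
  ∀ K : Submodule R (SolutionTerm R →₀ R),
    IsFPInjective (ModuleCat.of R ((SolutionTerm R →₀ R) ⧸ K)) →
      ∀ φ : K →ₗ[R] M, ∃ ψ : (SolutionTerm R →₀ R) →ₗ[R] M, ∀ x : K, ψ x = φ x

/-- Over a left coherent ring, an FP-injective module is injective as soon as it has the extension
property for a set of inclusions with FP-injective cokernel. Embed `M` in an injective module `E`
and let `y ∈ E` extend a map from a left ideal to `M`. The class of `y` in `E ⧸ M` lies in a small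
FP-injective submodule `N`, and the extension property splits the preimage of `N` in `E`; the
splitting moves `y` into `M`. -/
lemma IsLeftCoherent.injective_of_hasTermExtensions (hR : IsLeftCoherent R) {M : ModuleCat.{u} R}
    (hM : IsFPInjective M) (h : HasTermExtensions M) : Injective M := by
  suffices hB : Module.Baer R M by
    have := hB.injective
    exact Module.injective_object_of_injective_module R M
  intro I φ
  obtain ⟨E, ι, _, _⟩ : ∃ (E : ModuleCat.{u} R) (ι : M ⟶ E), Injective E ∧ Mono ι :=
    ⟨_, Injective.ι M, inferInstance, inferInstance⟩
  have hι : Function.Injective ι := (ModuleCat.mono_iff_injective _).1 inferInstance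
  have hS : (ShortComplex.mk ι (cokernel.π ι) (by simp)).ShortExact :=
    { exact := ShortComplex.exact_cokernel _ }
  have hQ : IsFPInjective (cokernel ι) :=
    hR.isFPInjective_of_shortExact hS hM (.of_injective inferInstance)
  have hπ : Function.Surjective (cokernel.π ι) :=
    (ModuleCat.epi_iff_surjective _).1 inferInstance
  have hex (x : E) (hx : cokernel.π ι x = 0) :
      ∃ m : M, ι m = x := (ShortComplex.moduleCat_exact_iff _).1 hS.exact x hx
  have hE : Module.Baer R E :=
    Module.Baer.of_injective ((Module.injective_iff_injective_object R E).2 inferInstance)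
  obtain ⟨θ, hθ⟩ := hE I (ι.hom.comp φ)
  -- `p` presents the closure of the class of `y`, and `g` lifts it to the injective module.
  set y := θ 1 with hy
  set e := cokernel.π ι y with he
  let p : (SolutionTerm R →₀ R) →ₗ[R] (cokernel ι : ModuleCat.{u} R) :=
    Finsupp.linearCombination R (SolutionTerm.eval (R := R) e)
  choose l hl using fun t ↦ hπ (SolutionTerm.eval (R := R) e t)
  let g : (SolutionTerm R →₀ R) →ₗ[R] E := Finsupp.linearCombination R l
  have hpg (x) : cokernel.π ι (g x) = p x := by
    have : (cokernel.π ι).hom.comp g = p := by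
      ext t
      simp [g, p, hl]
    exact congr($this x)
  have hp : LinearMap.range p = solutionClosure (R := R) e := by
    rw [Finsupp.range_linearCombination]
    exact Submodule.span_eq (solutionClosure (R := R) e)
  have hN : IsFPInjective (ModuleCat.of R ((SolutionTerm R →₀ R) ⧸ LinearMap.ker p)) :=
    (isFPInjective_solutionClosure hQ e).of_iso
      (p.quotKerEquivRange.trans (LinearEquiv.ofEq _ _ hp)).symm.toModuleIso
  choose f hf using fun x : LinearMap.ker p ↦ hex (g x) (by rw [hpg]; exact x.2)
  let f' : LinearMap.ker p →ₗ[R] M :=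
    { toFun := f
      map_add' := fun a b ↦ hι (by simp [hf])
      map_smul' := fun a b ↦ hι (by simp [hf]) }
  obtain ⟨ψ, hψ⟩ := h _ hN f'
  have hker (x) (hx : p x = 0) : g x = ι (ψ x) := by
    rw [hψ ⟨x, hx⟩]
    exact (hf ⟨x, hx⟩).symm
  let x₀ : SolutionTerm R →₀ R := Finsupp.single .gen 1
  have hx₀ : p x₀ = e := by simp [p, x₀, SolutionTerm.eval]
  obtain ⟨m, hm⟩ := hex (y - g x₀) (by rw [map_sub, hpg, hx₀, ← he, sub_self])
  refine ⟨LinearMap.toSpanSingleton R M (m + ψ x₀), fun r hr ↦ hι ?_⟩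
  have h₁ : r • y = ι (φ ⟨r, hr⟩) := by
    rw [hy, ← map_smul, smul_eq_mul, mul_one]
    exact hθ r hr
  have h₂ : p (r • x₀) = 0 := by
    rw [map_smul, hx₀, he, ← map_smul, h₁]
    exact congr($(cokernel.condition ι) _)
  have h₃ := hker _ h₂
  rw [LinearMap.toSpanSingleton_apply, map_smul, map_add, hm, ← h₁]
  rw [map_smul, map_smul, map_smul] at h₃
  rw [smul_add, smul_sub, h₃]
  abel

end SolutionTerms

/-! ### Exactness of `Hom(F, X)` -/

section HomExact

variable {R : Type u} [Ring R]

/-- The complex of abelian groups `Hom(F, X)` is exact. -/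
def IsHomExact (F : ModuleCat.{u} R) (X : ChainComplex (ModuleCat.{u} R) ℤ) : Prop :=
  ∀ i j k : ℤ, j + 1 = i → k + 1 = j → ∀ g : F ⟶ X.X j, g ≫ X.d j k = 0 →
    ∃ h : F ⟶ X.X i, h ≫ X.d i j = g

/-- `Hom(F, X)` is exact for all finitely presented `F`. -/
def IsFPHomExact (X : ChainComplex (ModuleCat.{u} R) ℤ) : Prop :=
  ∀ F : ModuleCat.{u} R, Module.FinitePresentation R F → IsHomExact F X

lemma IsHomExact.acyclic {X : ChainComplex (ModuleCat.{u} R) ℤ}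
    (hX : IsHomExact (ModuleCat.of R R) X) : X.Acyclic := by
  intro n
  rw [X.exactAt_iff' (n + 1) n (n - 1) (by simp) (by simp), ShortComplex.moduleCat_exact_iff]
  intro x hx
  obtain ⟨h, hh⟩ := hX (n + 1) n (n - 1) rfl (by simp)
    (ModuleCat.ofHom (LinearMap.toSpanSingleton R (X.X n) x))
    (ModuleCat.hom_ext (LinearMap.ext_ring (by
      change X.d n (n - 1) ((1 : R) • x) = 0
      rw [one_smul]
      exact hx)))
  exact ⟨h (1 : R), congr($hh (1 : R)).trans (one_smul R x)⟩

lemma HomologicalComplex.Acyclic.cycles_shortExact {X : ChainComplex (ModuleCat.{u} R) ℤ}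
    (hX : X.Acyclic) (n : ℤ) :
    (ShortComplex.mk (X.iCycles (n + 1)) (X.toCycles (n + 1) n)
      (by simp [← cancel_mono (X.iCycles n)])).ShortExact where
  exact := by
    refine ShortComplex.exact_of_f_is_kernel _ ?_
    refine KernelFork.IsLimit.ofι _ _ (fun g hg ↦ X.liftCycles g n (by simp) ?_)
      (fun g hg ↦ by simp) (fun g hg m hm ↦ by simp [← cancel_mono (X.iCycles (n + 1)), ← hm])
    rw [← X.toCycles_i (n + 1) n, reassoc_of% hg, zero_comp]
  mono_f := by dsimp; infer_instance
  epi_g := Preadditive.epi_of_isZero_cokernel' _ (X.homologyIsCokernel (n + 1) n (by simp))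
    (hX n).isZero_homology

/-- Pure exactness is exactness of `Hom(F, X)` for all finitely presented `F`. -/
lemma isPureExact_iff {X : ChainComplex (ModuleCat.{u} R) ℤ} :
    IsPureExact X ↔ IsFPHomExact X := by
  constructor
  · rintro ⟨-, hX⟩ F hF i j k rfl rfl g hg
    obtain ⟨h, hh⟩ := hX (k + 1) F hF (X.liftCycles g k (by simp) hg)
    exact ⟨h, by simpa using congr($hh ≫ X.iCycles _)⟩
  · intro hX
    refine ⟨(hX (ModuleCat.of R R) (Module.finitePresentation_of_projective R R)).acyclic,
      fun n F hF t ↦ ?_⟩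
    obtain ⟨h, hh⟩ := hX F hF (n + 1) n (n - 1) rfl (by simp) (t ≫ X.iCycles n) (by simp)
    exact ⟨h, by simpa [← cancel_mono (X.iCycles n)] using hh⟩

/-- FP-injective cycles make the sequences of cycles pure; conversely, the cycles of a pure exact
complex are pure submodules of its components. -/
lemma isExactWithFPInjectiveCycles_iff {X : ChainComplex (ModuleCat.{u} R) ℤ} :
    IsExactWithFPInjectiveCycles X ↔ IsFPHomExact X ∧ IsDegreewiseFPInjective X := by
  rw [← isPureExact_iff]
  constructor
  · rintro ⟨hX, hX'⟩
    refine ⟨⟨hX, fun n F hF t ↦ (hX' _).exists_lift (hX.cycles_shortExact n) hF t⟩, fun n ↦ ?_⟩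
    obtain ⟨n, rfl⟩ : ∃ m, n = m + 1 := ⟨n - 1, by simp⟩
    exact .of_shortExact_middle (hX.cycles_shortExact n) (hX' _) (hX' _)
  · rintro ⟨⟨hX, hX'⟩, hX''⟩
    refine ⟨hX, fun n ↦ ?_⟩
    obtain ⟨n, rfl⟩ : ∃ m, n = m + 1 := ⟨n - 1, by simp⟩
    exact .of_isPureEpi (hX.cycles_shortExact n) (hX'' _) (hX' n)

end HomExact

/-! ### Filtered colimits of modules -/

section FilteredColimits

variable {R : Type u} [Ring R] {J : Type u} [Preorder J] [IsFiltered J]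
  {G : J ⥤ ModuleCat.{u} R} {c : Cocone G}

/-- Two morphisms from a finitely generated module to a filtered diagram that agree in the colimit
agree at some stage. -/
lemma exists_comp_map_eq_of_isColimit (hc : IsColimit c) {M : ModuleCat.{u} R}
    (hM : Module.Finite R M) {j : J} (f g : M ⟶ G.obj j) (h : f ≫ c.ι.app j = g ≫ c.ι.app j) :
    ∃ (k : J) (φ : j ⟶ k), f ≫ G.map φ = g ≫ G.map φ := by
  classical
  have key (t : Finset M) :
      ∃ (k : J) (φ : j ⟶ k), ∀ x ∈ t, G.map φ (f x) = G.map φ (g x) := by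
    induction t using Finset.induction_on with
    | empty => exact ⟨j, 𝟙 j, by simp⟩
    | insert a t _ ih =>
      obtain ⟨k, φ, hφ⟩ := ih
      obtain ⟨l, α, β, hαβ⟩ :=
        Concrete.isColimit_exists_of_rep_eq G hc (f a) (g a) (by simpa using congr($h a))
      obtain rfl : α = β := Subsingleton.elim _ _
      obtain ⟨n, γ, δ, hγδ⟩ := IsFiltered.span φ α
      refine ⟨n, φ ≫ γ, fun x hx ↦ ?_⟩
      rcases Finset.mem_insert.1 hx with rfl | hx
      · simp [hγδ, hαβ]
      · simp [hφ x hx]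
  obtain ⟨t, ht⟩ := hM.fg_top
  obtain ⟨k, φ, hφ⟩ := key t
  refine ⟨k, φ, ModuleCat.hom_ext (LinearMap.ext_on (s := (t : Set M)) ht fun x hx ↦ hφ x hx)⟩

/-- A morphism from a finitely presented module to a filtered colimit factors through a stage. -/
lemma exists_factor_of_isColimit (hc : IsColimit c) {F : ModuleCat.{u} R}
    (hF : Module.FinitePresentation R F) (g : F ⟶ c.pt) :
    ∃ (j : J) (h : F ⟶ G.obj j), h ≫ c.ι.app j = g := by
  classical
  obtain ⟨n, K, e, hK⟩ := Module.FinitePresentation.exists_fin R F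
  let q : (Fin n → R) →ₗ[R] F := e.symm.toLinearMap.comp K.mkQ
  choose j y hy using fun i : Fin n ↦
    Concrete.isColimit_exists_rep G hc (g (q (Pi.single i 1)))
  obtain ⟨k, hk⟩ := IsFiltered.sup_objs_exists (Finset.univ.image j)
  let φ (i : Fin n) : j i ⟶ k := (hk (Finset.mem_image_of_mem j (Finset.mem_univ i))).some
  let ψ : ModuleCat.of R (Fin n → R) ⟶ G.obj k :=
    ModuleCat.ofHom (Fintype.linearCombination R fun i ↦ G.map (φ i) (y i))
  have hψ : ψ ≫ c.ι.app k = ModuleCat.ofHom q ≫ g := by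
    ext i
    have h : c.ι.app k (G.map (φ i) (y i)) = g (q (Pi.single i 1)) := by
      rw [← hy, ← c.w (φ i)]
      simp
    simpa [ψ] using h
  let ι : ModuleCat.of R K ⟶ ModuleCat.of R (Fin n → R) := ModuleCat.ofHom K.subtype
  obtain ⟨l, α, hα⟩ := exists_comp_map_eq_of_isColimit hc (M := ModuleCat.of R K)
    (Module.Finite.iff_fg.2 hK) (ι ≫ ψ) 0 (by
      rw [Category.assoc, hψ, zero_comp]
      ext x
      have hx : K.mkQ x = 0 := by simp
      have hqx : q x = 0 := by rw [LinearMap.comp_apply, hx, map_zero]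
      exact (congr_arg g hqx).trans (map_zero g.hom))
  have hker : K ≤ LinearMap.ker (ψ ≫ G.map α).hom := fun x hx ↦ by
    simpa [ι] using congr($hα ⟨x, hx⟩)
  refine ⟨l, ModuleCat.ofHom ((K.liftQ _ hker).comp e.toLinearMap), ?_⟩
  ext x
  obtain ⟨x, rfl⟩ : ∃ y, q y = x := (e.symm.surjective.comp K.mkQ_surjective) x
  have := congr($hψ x)
  simpa [q] using this

/-- Over a left coherent ring, FP-injective modules are closed under filtered colimits. -/
lemma IsLeftCoherent.isFPInjective_of_isColimit (hR : IsLeftCoherent R) (hc : IsColimit c)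
    (hG : ∀ j, IsFPInjective (G.obj j)) : IsFPInjective c.pt := by
  rw [isFPInjective_iff_exists_extension]
  intro n K hK φ
  obtain ⟨j, h, hh⟩ := exists_factor_of_isColimit hc (F := ModuleCat.of R K)
    (hR.finitePresentation_of_fg K hK) (ModuleCat.ofHom φ)
  obtain ⟨ψ, hψ⟩ := isFPInjective_iff_exists_extension.1 (hG j) n K hK h.hom
  refine ⟨(c.ι.app j).hom.comp ψ, fun x ↦ ?_⟩
  simpa [hψ] using congr($hh x)

end FilteredColimits

/-! ### FP-acyclic extensions of complexes -/

section FPAcyclicExtensions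

variable {R : Type u} [Ring R]

/-- A morphism `f : X ⟶ Y` to a degreewise FP-injective complex such that, for finitely presented
`F`, every `g : F ⟶ Y_j` whose boundary comes from `X` is the sum of a boundary and of a morphism
that comes from `X`. If `f` is a monomorphism and `X` is degreewise FP-injective, this says that
`Hom(F, -)` is exact on the cokernel of `f`; the present form passes to filtered colimits without
any exactness argument. -/
structure IsFPAcyclicExtension {X Y : ChainComplex (ModuleCat.{u} R) ℤ} (f : X ⟶ Y) : Prop where
  isDegreewiseFPInjective : IsDegreewiseFPInjective Y
  exists_eq_add : ∀ F : ModuleCat.{u} R, Module.FinitePresentation R F →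
    ∀ i j k : ℤ, j + 1 = i → k + 1 = j → ∀ (g : F ⟶ Y.X j) (a : F ⟶ X.X k),
      g ≫ Y.d j k = a ≫ f.f k →
        ∃ (h : F ⟶ Y.X i) (x : F ⟶ X.X j), g = h ≫ Y.d i j + x ≫ f.f j

variable {X Y Z : ChainComplex (ModuleCat.{u} R) ℤ}

lemma IsFPAcyclicExtension.id (hX : IsDegreewiseFPInjective X) :
    IsFPAcyclicExtension (𝟙 X) where
  isDegreewiseFPInjective := hX
  exists_eq_add _ _ _ _ _ _ _ g _ _ := ⟨0, g, by simp⟩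

lemma IsFPAcyclicExtension.comp {f : X ⟶ Y} {g : Y ⟶ Z} [Mono g]
    (hf : IsFPAcyclicExtension f) (hg : IsFPAcyclicExtension g) :
    IsFPAcyclicExtension (f ≫ g) where
  isDegreewiseFPInjective := hg.isDegreewiseFPInjective
  exists_eq_add F hF i j k hi hj t a hta := by
    obtain ⟨h, y, rfl⟩ := hg.exists_eq_add F hF i j k hi hj t (a ≫ f.f k) (by simpa using hta)
    obtain ⟨h', x, rfl⟩ := hf.exists_eq_add F hF i j k hi hj y a (by
      rw [← cancel_mono (g.f k)]
      simpa using hta)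
    exact ⟨h + h' ≫ g.f i, x, by simp [add_assoc]⟩

lemma IsFPAcyclicExtension.of_iso_comp {f : X ⟶ Y} (e : Z ≅ X)
    (hf : IsFPAcyclicExtension f) : IsFPAcyclicExtension (e.hom ≫ f) where
  isDegreewiseFPInjective := hf.isDegreewiseFPInjective
  exists_eq_add F hF i j k hi hj t a hta := by
    obtain ⟨h, x, rfl⟩ := hf.exists_eq_add F hF i j k hi hj t (a ≫ e.hom.f k) (by simpa using hta)
    exact ⟨h, x ≫ e.inv.f j, by simp [← HomologicalComplex.comp_f_assoc]⟩

/-- Monomorphisms with degreewise FP-injective cokernel on which all functors `Hom(F, -)` with `F`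
finitely presented are exact. -/
def fpAcyclicMonomorphisms (R : Type u) [Ring R] :
    MorphismProperty (ChainComplex (ModuleCat.{u} R) ℤ) :=
  fun _ _ f ↦ Mono f ∧ IsDegreewiseFPInjective (cokernel f) ∧ IsFPHomExact (cokernel f)

lemma fpAcyclicMonomorphisms.isFPAcyclicExtension {f : X ⟶ Y}
    (hf : fpAcyclicMonomorphisms R f) (hX : IsDegreewiseFPInjective X) :
    IsFPAcyclicExtension f := by
  obtain ⟨_, hC, hC'⟩ := hf
  have hS : (ShortComplex.mk f (cokernel.π f) (by simp)).ShortExact :=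
    { exact := ShortComplex.exact_cokernel _ }
  have hSn (n : ℤ) : (ShortComplex.mk (f.f n) ((cokernel.π f).f n)
      (by simp [← HomologicalComplex.comp_f])).ShortExact :=
    hS.map_of_exact (HomologicalComplex.eval (ModuleCat.{u} R) _ n)
  refine ⟨fun n ↦ .of_shortExact_middle (hSn n) (hX n) (hC n), ?_⟩
  intro F hF i j k hi hj g a hga
  obtain ⟨h, hh⟩ := hC' F hF i j k hi hj (g ≫ (cokernel.π f).f j) (by
    rw [Category.assoc, HomologicalComplex.Hom.comm, reassoc_of% hga,
      ← HomologicalComplex.comp_f, cokernel.condition, HomologicalComplex.zero_f, comp_zero])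
  obtain ⟨h, rfl⟩ : ∃ h' : F ⟶ Y.X i, h' ≫ (cokernel.π f).f i = h :=
    (hX i).exists_lift (hSn i) hF h
  have h0 : (g - h ≫ Y.d i j) ≫ (cokernel.π f).f j = 0 := by
    rw [Preadditive.sub_comp, ← hh]
    simp
  have := (hSn j).mono_f
  have hx : (hSn j).exact.lift _ h0 ≫ f.f j = g - h ≫ Y.d i j := (hSn j).exact.lift_f _ h0
  exact ⟨h, (hSn j).exact.lift _ h0, by rw [hx, add_sub_cancel]⟩

/-- FP-acyclic extensions of the initial term of a filtered diagram pass to the colimit, since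
finitely presented modules map to the colimit through a stage. -/
lemma IsLeftCoherent.isFPAcyclicExtension_of_isColimit (hR : IsLeftCoherent R) {J : Type u}
    [LinearOrder J] [OrderBot J] {G : J ⥤ ChainComplex (ModuleCat.{u} R) ℤ} {c : Cocone G}
    (hc : IsColimit c) (hG : ∀ j : J, IsFPAcyclicExtension (G.map (homOfLE (bot_le : ⊥ ≤ j)))) :
    IsFPAcyclicExtension (c.ι.app ⊥) := by
  have hcn (n : ℤ) := isColimitOfPreserves (HomologicalComplex.eval (ModuleCat.{u} R) _ n) hc
  refine ⟨fun n ↦ hR.isFPInjective_of_isColimit (hcn n)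
    fun j ↦ (hG j).isDegreewiseFPInjective n, ?_⟩
  intro F hF i j k hi hj g a hga
  obtain ⟨l, t, rfl⟩ : ∃ (l : J) (t : F ⟶ (G.obj l).X j), t ≫ (c.ι.app l).f j = g :=
    exists_factor_of_isColimit (hcn j) hF g
  have heq : (t ≫ (G.obj l).d j k) ≫ (c.ι.app l).f k =
      (a ≫ (G.map (homOfLE bot_le)).f k) ≫ (c.ι.app l).f k := by
    rw [Category.assoc, Category.assoc, ← HomologicalComplex.comp_f, c.w,
      ← HomologicalComplex.Hom.comm]
    simpa using hga
  obtain ⟨m, φ, hφ⟩ : ∃ (m : J) (φ : l ⟶ m), (t ≫ (G.obj l).d j k) ≫ (G.map φ).f k =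
      (a ≫ (G.map (homOfLE bot_le)).f k) ≫ (G.map φ).f k :=
    exists_comp_map_eq_of_isColimit (hcn k) (M := F) inferInstance _ _ heq
  obtain ⟨h, x, hx⟩ := (hG m).exists_eq_add F hF i j k hi hj (t ≫ (G.map φ).f j) a (by
    rw [Category.assoc, HomologicalComplex.Hom.comm, ← Category.assoc, hφ, Category.assoc,
      ← HomologicalComplex.comp_f, ← G.map_comp]
    rfl)
  refine ⟨h ≫ (c.ι.app m).f i, x, ?_⟩
  have := congr($hx ≫ (c.ι.app m).f j)
  dsimp
  rw [Category.assoc, ← HomologicalComplex.comp_f, c.w, Preadditive.add_comp, Category.assoc,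
    Category.assoc, ← HomologicalComplex.comp_f, c.w] at this
  rw [this]
  simp

/-- Transfinite compositions of monomorphisms with FP-acyclic cokernel are FP-acyclic extensions. -/
lemma IsLeftCoherent.isFPAcyclicExtension_of_transfiniteCompositionOfShape
    (hR : IsLeftCoherent R) {J : Type u} [LinearOrder J] [OrderBot J] [SuccOrder J]
    [WellFoundedLT J] {f : X ⟶ Y} (hX : IsDegreewiseFPInjective X)
    (h : (fpAcyclicMonomorphisms R).TransfiniteCompositionOfShape J f) :
    IsFPAcyclicExtension f := by
  have hmono := h.ofLE (W' := MorphismProperty.monomorphisms _) (fun _ _ _ hf ↦ hf.1)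
  have hbot : IsDegreewiseFPInjective (h.F.obj ⊥) := fun n ↦
    (hX n).of_iso ((HomologicalComplex.eval _ _ n).mapIso h.isoBot.symm)
  have key (j : J) : IsFPAcyclicExtension (h.F.map (homOfLE (bot_le : ⊥ ≤ j))) := by
    induction j using SuccOrder.limitRecOn with
    | isMin j hj =>
      obtain rfl := hj.eq_bot
      simpa using IsFPAcyclicExtension.id hbot
    | succ j hj hj' =>
      rw [← homOfLE_comp bot_le (Order.le_succ j), h.F.map_comp]
      have : Mono (h.F.map (homOfLE (Order.le_succ j))) := (h.map_mem j hj).1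
      exact hj'.comp ((h.map_mem j hj).isFPAcyclicExtension hj'.isDegreewiseFPInjective)
    | isSuccLimit j hj hj' =>
      let : OrderBot (Set.Iio j) :=
        { bot := ⟨⊥, Order.IsSuccLimit.bot_lt hj⟩
          bot_le j := bot_le }
      exact hR.isFPAcyclicExtension_of_isColimit
        (h.F.isColimitOfIsWellOrderContinuous j hj) (fun k ↦ hj' _ k.2)
  have := (hR.isFPAcyclicExtension_of_isColimit h.isColimit key).of_iso_comp h.isoBot.symm
  simpa using this

end FPAcyclicExtensions

/-! ### Coproducts of complexes -/

section Coproducts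

variable {R : Type u} [Ring R]

lemma IsDegreewiseFPInjective.of_iso {X Y : ChainComplex (ModuleCat.{u} R) ℤ} (e : X ≅ Y)
    (hX : IsDegreewiseFPInjective X) : IsDegreewiseFPInjective Y :=
  fun n ↦ (hX n).of_iso ((HomologicalComplex.eval _ _ n).mapIso e)

lemma IsFPHomExact.of_iso {X Y : ChainComplex (ModuleCat.{u} R) ℤ} (e : X ≅ Y)
    (hX : IsFPHomExact X) : IsFPHomExact Y := by
  intro F hF i j k hi hj g hg
  obtain ⟨h, hh⟩ := hX F hF i j k hi hj (g ≫ e.inv.f j) (by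
    rw [Category.assoc, HomologicalComplex.Hom.comm, reassoc_of% hg, zero_comp])
  exact ⟨h ≫ e.hom.f i, by rw [Category.assoc, HomologicalComplex.Hom.comm, reassoc_of% hh]; simp⟩

variable {J : Type u} (C : J → ChainComplex (ModuleCat.{u} R) ℤ)

open Classical in
/-- A morphism from a finitely generated module to a coproduct lands in a finite subcoproduct. -/
lemma exists_eq_sum_comp_sigmaι {M : ModuleCat.{u} R} (hM : Module.Finite R M) {n : ℤ}
    (g : M ⟶ (∐ C).X n) :
    ∃ s : Finset J, g = ∑ j ∈ s, (g ≫ (Sigma.π C j).f n) ≫ (Sigma.ι C j).f n := by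
  let p (s : Finset J) : (∐ C).X n ⟶ (∐ C).X n :=
    ∑ j ∈ s, (Sigma.π C j).f n ≫ (Sigma.ι C j).f n
  let S : Submodule R ((∐ C).X n) :=
    { carrier := {y | ∃ s, ∀ t, s ⊆ t → p t y = y}
      add_mem' := by
        rintro y z ⟨s, hs⟩ ⟨t, ht⟩
        refine ⟨s ∪ t, fun v hv ↦ ?_⟩
        rw [map_add, hs v (Finset.union_subset_left hv), ht v (Finset.union_subset_right hv)]
      zero_mem' := ⟨∅, fun _ _ ↦ map_zero (p _).hom⟩
      smul_mem' := by
        rintro r y ⟨s, hs⟩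
        refine ⟨s, fun v hv ↦ ?_⟩
        rw [map_smul, hs v hv] }
  have hS : S = ⊤ := by
    have h : ModuleCat.ofHom S.mkQ = 0 := by
      refine (isColimitOfPreserves (HomologicalComplex.eval (ModuleCat.{u} R) _ n)
        (coproductIsCoproduct C)).hom_ext fun ⟨j⟩ ↦ ?_
      ext y
      refine (Submodule.Quotient.mk_eq_zero S).2 ⟨{j}, fun t ht ↦ ?_⟩
      change ((Sigma.ι C j).f n ≫ p t) y = (Sigma.ι C j).f n y
      congr 2
      simp only [p, Preadditive.comp_sum]
      rw [Finset.sum_eq_single_of_mem j (by simpa using ht)]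
      · rw [← HomologicalComplex.comp_f_assoc, Sigma.ι_π_eq_id]
        simp
      · intro k _ hk
        rw [← HomologicalComplex.comp_f_assoc, Sigma.ι_π_of_ne _ hk.symm]
        simp
    rw [← S.ker_mkQ, ← ModuleCat.hom_ofHom S.mkQ, h]
    simp
  obtain ⟨G, hG⟩ := hM.fg_top
  have hmem (x : M) : g x ∈ S := hS ▸ Submodule.mem_top
  choose s hs using hmem
  refine ⟨G.biUnion s, ModuleCat.hom_ext (LinearMap.ext_on (s := (G : Set M)) hG fun x hx ↦ ?_)⟩
  have := hs x (G.biUnion s) (Finset.subset_biUnion_of_mem s hx)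
  rw [← this]
  simp [p]

variable {C}

lemma isDegreewiseFPInjective_sigma (hC : ∀ j, IsDegreewiseFPInjective (C j)) :
    IsDegreewiseFPInjective (∐ C) := by
  classical
  intro n
  rw [isFPInjective_iff_exists_extension]
  intro m K hK φ
  obtain ⟨s, hs⟩ := exists_eq_sum_comp_sigmaι C (M := ModuleCat.of R K)
    (Module.Finite.iff_fg.2 hK) (ModuleCat.ofHom φ)
  choose ψ hψ using fun j ↦ isFPInjective_iff_exists_extension.1 (hC j n) m K hK
    (ModuleCat.ofHom φ ≫ (Sigma.π C j).f n).hom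
  let ψ' (j : J) : ModuleCat.of R (Fin m → R) ⟶ (C j).X n := ModuleCat.ofHom (ψ j)
  have hψ' (j : J) : ModuleCat.ofHom K.subtype ≫ ψ' j =
      ModuleCat.ofHom φ ≫ (Sigma.π C j).f n := by
    ext x
    exact hψ j x
  refine ⟨(∑ j ∈ s, ψ' j ≫ (Sigma.ι C j).f n).hom, fun x ↦ ?_⟩
  have h : ModuleCat.ofHom K.subtype ≫ ∑ j ∈ s, ψ' j ≫ (Sigma.ι C j).f n = ModuleCat.ofHom φ := by
    rw [Preadditive.comp_sum, hs]
    refine Finset.sum_congr rfl fun j _ ↦ ?_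
    rw [reassoc_of% hψ' j, Category.assoc]
  exact congr($h x)

lemma isFPHomExact_sigma (hC : ∀ j, IsFPHomExact (C j)) : IsFPHomExact (∐ C) := by
  classical
  intro F hF i j k hi hj g hg
  obtain ⟨s, hs⟩ := exists_eq_sum_comp_sigmaι C (M := F) inferInstance g
  choose h hh using fun l ↦ hC l F hF i j k hi hj (g ≫ (Sigma.π C l).f j) (by
    rw [Category.assoc, HomologicalComplex.Hom.comm, reassoc_of% hg, zero_comp])
  refine ⟨∑ l ∈ s, h l ≫ (Sigma.ι C l).f i, ?_⟩
  rw [Preadditive.sum_comp, hs]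
  refine Finset.sum_congr rfl fun l _ ↦ ?_
  rw [Category.assoc, HomologicalComplex.Hom.comm, reassoc_of% hh l, Category.assoc]

open MorphismProperty

instance : (fpAcyclicMonomorphisms R).RespectsIso :=
  .of_respects_arrow_iso _ fun f g e ⟨hf, h, h'⟩ ↦
    have i : cokernel f.hom ≅ cokernel g.hom :=
      cokernel.mapIso _ _ (Arrow.leftFunc.mapIso e) (Arrow.rightFunc.mapIso e) e.hom.w.symm
    ⟨((monomorphisms _).arrow_mk_iso_iff e).1 hf, h.of_iso i, h'.of_iso i⟩

instance : (fpAcyclicMonomorphisms R).IsStableUnderCobaseChange where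
  of_isPushout {_ _ _ _ f g f' g'} sq := fun ⟨hf, h, h'⟩ ↦ by
    have := isIso_cokernel_map_of_isPushout sq.flip
    have i := asIso (cokernel.map _ _ _ _ sq.flip.w)
    exact ⟨(monomorphisms _).of_isPushout sq hf, h.of_iso i, h'.of_iso i⟩

instance : IsStableUnderCoproducts.{u} (fpAcyclicMonomorphisms R) where
  isStableUnderCoproductsOfShape J := .mk _ J fun X Y _ _ f hf ↦ by
    have (j : J) : Mono (f j) := (hf j).1
    let i : (∐ fun j ↦ cokernel (f j)) ≅ cokernel (Limits.Sigma.map f) :=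
      { hom := Limits.Sigma.desc fun j ↦
          cokernel.map _ _ (Sigma.ι X j) (Sigma.ι Y j) (Sigma.ι_map f j).symm
        inv := cokernel.desc _ (Limits.Sigma.map fun j ↦ cokernel.π (f j)) (by
          refine Limits.Sigma.hom_ext _ _ fun j ↦ ?_
          simp)
        hom_inv_id := by
          refine Limits.Sigma.hom_ext _ _ fun j ↦ ?_
          simp [← cancel_epi (cokernel.π (f j))]
        inv_hom_id := by
          rw [← cancel_epi (cokernel.π _)]
          refine Limits.Sigma.hom_ext _ _ fun j ↦ ?_
          simp }
    exact ⟨inferInstance, (isDegreewiseFPInjective_sigma fun j ↦ (hf j).2.1).of_iso i,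
      (isFPHomExact_sigma fun j ↦ (hf j).2.2).of_iso i⟩

end Coproducts

/-! ### Disk complexes and the small object argument -/

section Disks

variable {R : Type u} [Ring R]

/-- The disk complex `⋯ ⟶ 0 ⟶ A ⟶ A ⟶ 0 ⟶ ⋯` with `A` in degrees `n + 1` and `n`. -/
noncomputable abbrev disk (n : ℤ) (A : ModuleCat.{u} R) : ChainComplex (ModuleCat.{u} R) ℤ :=
  HomologicalComplex.double (c := ComplexShape.down ℤ) (𝟙 A)
    (show (ComplexShape.down ℤ).Rel (n + 1) n from rfl)

/-- Morphisms from a disk complex are morphisms to the component of upper degree. -/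
noncomputable def diskHomEquiv {n : ℤ} {A : ModuleCat.{u} R}
    {X : ChainComplex (ModuleCat.{u} R) ℤ} : (disk n A ⟶ X) ≃ (A ⟶ X.X (n + 1)) :=
  (HomologicalComplex.evalCompCoyonedaCorepresentableByDoubleId
    (show (ComplexShape.down ℤ).Rel (n + 1) n from rfl) (by simp) A).homEquiv

variable {n : ℤ} {A B : ModuleCat.{u} R} {X Y : ChainComplex (ModuleCat.{u} R) ℤ}

lemma diskHomEquiv_apply (f : disk n A ⟶ X) :
    diskHomEquiv f = (HomologicalComplex.doubleXIso₀ (𝟙 A) _).inv ≫ f.f (n + 1) := rfl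

lemma diskHomEquiv_comp (f : disk n A ⟶ X) (g : X ⟶ Y) :
    diskHomEquiv (f ≫ g) = diskHomEquiv f ≫ g.f (n + 1) := by
  simp [diskHomEquiv_apply]

@[simp]
lemma diskHomEquiv_zero : diskHomEquiv (0 : disk n A ⟶ X) = 0 := by
  simp [diskHomEquiv_apply]

/-- Disk complexes are functorial. -/
noncomputable def diskMap (n : ℤ) (f : A ⟶ B) : disk n A ⟶ disk n B :=
  diskHomEquiv.symm (f ≫ diskHomEquiv (𝟙 _))

lemma diskHomEquiv_diskMap_comp (f : A ⟶ B) (g : disk n B ⟶ X) :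
    diskHomEquiv (diskMap n f ≫ g) = f ≫ diskHomEquiv g := by
  rw [diskHomEquiv_comp, diskMap, Equiv.apply_symm_apply, Category.assoc, ← diskHomEquiv_comp,
    Category.id_comp]

lemma diskMap_comp_eq_iff (f : A ⟶ B) (g : disk n B ⟶ X) (h : disk n A ⟶ X) :
    diskMap n f ≫ g = h ↔ f ≫ diskHomEquiv g = diskHomEquiv h := by
  rw [← diskHomEquiv_diskMap_comp, EmbeddingLike.apply_eq_iff_eq]

lemma disk_isZero (A : ModuleCat.{u} R) {k : ℤ} (h₀ : k ≠ n + 1) (h₁ : k ≠ n) :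
    IsZero ((disk n A).X k) :=
  HomologicalComplex.isZero_double_X _ _ _ h₀ h₁

/-- The upper component of a disk complex. -/
noncomputable abbrev diskXIso₀ (n : ℤ) (A : ModuleCat.{u} R) : (disk n A).X (n + 1) ≅ A :=
  HomologicalComplex.doubleXIso₀ (𝟙 A) _

/-- The lower component of a disk complex. -/
noncomputable abbrev diskXIso₁ (n : ℤ) (A : ModuleCat.{u} R) : (disk n A).X n ≅ A :=
  HomologicalComplex.doubleXIso₁ (𝟙 A) _ (by simp)

lemma disk_d (n : ℤ) (A : ModuleCat.{u} R) :
    (disk n A).d (n + 1) n = (diskXIso₀ n A).hom ≫ (diskXIso₁ n A).inv := by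
  rw [HomologicalComplex.double_d _ _ (by simp), Category.id_comp]

instance (n : ℤ) (A : ModuleCat.{u} R) : IsIso ((disk n A).d (n + 1) n) := by
  rw [disk_d]
  infer_instance

lemma diskMap_f₀ (n : ℤ) (f : A ⟶ B) :
    (diskMap n f).f (n + 1) = (diskXIso₀ n A).hom ≫ f ≫ (diskXIso₀ n B).inv := by
  have h : (diskXIso₀ n A).inv ≫ (diskMap n f).f (n + 1) = f ≫ (diskXIso₀ n B).inv := by
    rw [← diskHomEquiv_apply, diskMap, Equiv.apply_symm_apply, diskHomEquiv_apply]
    simp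
  rw [← h, Iso.hom_inv_id_assoc]

lemma mono_diskMap (n : ℤ) (f : A ⟶ B) [Mono f] : Mono (diskMap n f) := by
  have h₀ : Mono ((diskMap n f).f (n + 1)) := by
    rw [diskMap_f₀]
    infer_instance
  have h (k : ℤ) : Mono ((diskMap n f).f k) := by
    by_cases hk₀ : k = n + 1
    · subst hk₀
      exact h₀
    by_cases hk₁ : k = n
    · subst hk₁
      have : (diskMap k f).f k =
          inv ((disk k A).d (k + 1) k) ≫ (diskMap k f).f (k + 1) ≫ (disk k B).d (k + 1) k := by
        simp
      rw [this]
      infer_instance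
    · exact ⟨fun g h _ ↦ (disk_isZero A hk₀ hk₁).eq_of_tgt _ _⟩
  exact HomologicalComplex.mono_of_mono_f _ h

lemma isDegreewiseFPInjective_disk (n : ℤ) (hA : IsFPInjective A) :
    IsDegreewiseFPInjective (disk n A) := by
  intro k
  by_cases hk₀ : k = n + 1
  · subst hk₀
    exact hA.of_iso (diskXIso₀ n A).symm
  by_cases hk₁ : k = n
  · subst hk₁
    exact hA.of_iso (diskXIso₁ k A).symm
  · exact .of_injective (disk_isZero A hk₀ hk₁).injective

lemma isFPHomExact_disk (n : ℤ) (A : ModuleCat.{u} R) : IsFPHomExact (disk n A) := by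
  rintro F - i j k rfl rfl g hg
  by_cases hk₀ : k = n
  · subst hk₀
    exact ⟨0, by rw [zero_comp, ← cancel_mono ((disk k A).d (k + 1) k), hg, zero_comp]⟩
  by_cases hk₁ : k + 1 = n
  · subst hk₁
    exact ⟨g ≫ inv ((disk (k + 1) A).d (k + 1 + 1) (k + 1)), by simp⟩
  · exact ⟨0, (disk_isZero A (by simpa using hk₀) hk₁).eq_of_tgt _ _⟩

/-- The disk on a monomorphism with FP-injective cokernel has the disk on the cokernel as its
cokernel. -/
lemma fpAcyclicMonomorphisms_diskMap (n : ℤ) {S : ShortComplex (ModuleCat.{u} R)}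
    (hS : S.ShortExact) (h₃ : IsFPInjective S.X₃) :
    fpAcyclicMonomorphisms R (diskMap n S.f) := by
  have := hS.mono_f
  have := hS.epi_g
  have hw : S.f ≫ diskHomEquiv (cokernel.π (diskMap n S.f)) = 0 := by
    rw [← diskHomEquiv_diskMap_comp, cokernel.condition, diskHomEquiv_zero]
  obtain ⟨t, ht⟩ : ∃ t, S.g ≫ t = diskHomEquiv (cokernel.π (diskMap n S.f)) :=
    ⟨hS.exact.desc _ hw, hS.exact.g_desc _ hw⟩
  have hS0 : diskMap n S.f ≫ diskMap n S.g = 0 := by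
    rw [diskMap_comp_eq_iff, diskMap, Equiv.apply_symm_apply, S.zero_assoc, zero_comp,
      diskHomEquiv_zero]
  have h₁ : diskMap n S.g ≫ diskHomEquiv.symm t = cokernel.π (diskMap n S.f) := by
    rw [diskMap_comp_eq_iff, Equiv.apply_symm_apply, ht]
  let e : disk n S.X₃ ≅ cokernel (diskMap n S.f) :=
    { hom := diskHomEquiv.symm t
      inv := cokernel.desc _ (diskMap n S.g) hS0
      hom_inv_id := by
        apply diskHomEquiv.injective
        rw [← cancel_epi S.g, ← diskHomEquiv_diskMap_comp, ← diskHomEquiv_diskMap_comp,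
          reassoc_of% h₁]
        simp
      inv_hom_id := by
        rw [← cancel_epi (cokernel.π _)]
        simp [h₁] }
  exact ⟨mono_diskMap n S.f, (isDegreewiseFPInjective_disk n h₃).of_iso e,
    (isFPHomExact_disk n S.X₃).of_iso e⟩

end Disks

section SmallObjectArgument

variable (R : Type u) [Ring R]

open MorphismProperty ZeroObject

/-- The set of disks on the inclusions, into the free module on the set of terms, that have an
FP-injective cokernel. By `IsLeftCoherent.injective_of_hasTermExtensions`, they detect injectivity
of FP-injective components. -/
noncomputable def generatingDiskMaps : MorphismProperty (ChainComplex (ModuleCat.{u} R) ℤ) :=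
  ofHoms fun p : ℤ × { K : Submodule R (SolutionTerm R →₀ R) //
      IsFPInjective (ModuleCat.of R ((SolutionTerm R →₀ R) ⧸ K)) } ↦
    diskMap p.1 (quotientShortComplex p.2.1).f

instance : IsSmall.{u} (generatingDiskMaps R) := by
  dsimp [generatingDiskMaps]
  infer_instance

lemma generatingDiskMaps_le : generatingDiskMaps R ≤ fpAcyclicMonomorphisms R := by
  rintro _ _ _ ⟨n, K, hK⟩
  exact fpAcyclicMonomorphisms_diskMap n (quotientShortComplex_shortExact K) hK

lemma pushouts_coproducts_generatingDiskMaps_le :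
    (coproducts.{u} (generatingDiskMaps R)).pushouts ≤ fpAcyclicMonomorphisms R := by
  simpa using generatingDiskMaps_le R

instance : HasSmallObjectArgument.{u} (generatingDiskMaps R) := by
  obtain ⟨κ, hκ', hκ⟩ := HasCardinalLT.exists_regular_cardinal_forall.{u}
    fun p : ℤ × Submodule R (SolutionTerm R →₀ R) ↦
      Subobject (disk p.1 (ModuleCat.of R p.2))
  have : Fact κ.IsRegular := ⟨hκ'⟩
  have : Nonempty κ.ord.ToType := by simpa using hκ'.ne_zero
  have := WellFoundedLT.toOrderBot κ.ord.ToType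
  exact ⟨κ, inferInstance, inferInstance,
    { preservesColimit {A B X Y} i hi f hf := by
        let hf' : (monomorphisms _).TransfiniteCompositionOfShape κ.ord.ToType f :=
          { toTransfiniteCompositionOfShape := hf.toTransfiniteCompositionOfShape
            map_mem j hj := by
              have := (hf.attachCells j hj).pushouts_coproducts
              simp only [ofHoms_homFamily] at this
              exact (pushouts_coproducts_generatingDiskMaps_le R _ this).1 }
        have (j j' : κ.ord.ToType) (φ : j ⟶ j') : Mono (hf'.F.map φ) := hf'.mem_map φ
        apply IsGrothendieckAbelian.preservesColimit_coyoneda_obj_of_mono (Y := hf'.F) (κ := κ)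
        obtain ⟨n, K, hK⟩ := hi
        exact hκ ⟨n, K⟩ }⟩

variable {R}

/-- A morphism of complexes whose components have the right lifting property with respect to
monomorphisms has the right lifting property with respect to disks on monomorphisms. -/
lemma generatingDiskMaps_rlp_of_degreewise {X Y : ChainComplex (ModuleCat.{u} R) ℤ} (p : X ⟶ Y)
    (hp : ∀ n, (monomorphisms (ModuleCat.{u} R)).rlp (p.f n)) : (generatingDiskMaps R).rlp p := by
  rintro _ _ _ ⟨n, K, hK⟩
  refine ⟨fun {a b} sq ↦ ?_⟩
  have sq' : CommSq (diskHomEquiv a) (quotientShortComplex K).f (p.f (n + 1)) (diskHomEquiv b) :=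
    ⟨by rw [← diskHomEquiv_comp, sq.w, diskHomEquiv_diskMap_comp]⟩
  have := hp (n + 1) (quotientShortComplex K).f
    ((ModuleCat.mono_iff_injective _).2 K.subtype_injective)
  refine ⟨⟨⟨diskHomEquiv.symm sq'.lift, ?_, ?_⟩⟩⟩
  · rw [diskMap_comp_eq_iff, Equiv.apply_symm_apply, sq'.fac_left]
  · apply diskHomEquiv.injective
    rw [diskHomEquiv_comp, Equiv.apply_symm_apply, sq'.fac_right]

/-- Over a left coherent ring, a degreewise FP-injective complex embeds in a degreewise injective
one by an FP-acyclic extension with a left lifting property. The small object argument for the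
factorization of `X ⟶ 0` provides it. -/
lemma IsLeftCoherent.exists_isFPAcyclicExtension (hR : IsLeftCoherent R)
    (X : ChainComplex (ModuleCat.{u} R) ℤ) (hX : IsDegreewiseFPInjective X) :
    ∃ (Y : ChainComplex (ModuleCat.{u} R) ℤ) (f : X ⟶ Y), Mono f ∧ IsDegreewiseInjective Y ∧
      IsFPAcyclicExtension f ∧ (generatingDiskMaps R).rlp.llp f := by
  have hle := pushouts_coproducts_generatingDiskMaps_le R
  let κ := (generatingDiskMaps R).smallObjectκ
  have : Fact κ.IsRegular := smallObjectκ_isRegular _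
  let f := SmallObject.ιObj (generatingDiskMaps R) κ (0 : X ⟶ 0)
  obtain ⟨h⟩ := SmallObject.transfiniteCompositionsOfShape_ιObj (generatingDiskMaps R) κ
    (0 : X ⟶ 0)
  have hf : IsFPAcyclicExtension f :=
    hR.isFPAcyclicExtension_of_transfiniteCompositionOfShape hX (h.ofLE hle)
  refine ⟨_, f, (monomorphisms _).transfiniteCompositionsOfShape_le _ _
    ⟨h.ofLE (hle.trans fun _ _ _ hf ↦ hf.1)⟩, fun n ↦ ?_, hf,
    SmallObject.llp_rlp_ιObj (generatingDiskMaps R) κ (0 : X ⟶ 0)⟩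
  refine hR.injective_of_hasTermExtensions (hf.isDegreewiseFPInjective n) fun K hK φ ↦ ?_
  obtain ⟨n, rfl⟩ : ∃ m, n = m + 1 := ⟨n - 1, by simp⟩
  have := SmallObject.rlp_πObj (generatingDiskMaps R) κ (0 : X ⟶ 0) _ ⟨n, K, hK⟩
  have sq : CommSq (diskHomEquiv.symm (ModuleCat.ofHom φ)) (diskMap n (quotientShortComplex K).f)
      (SmallObject.πObj (generatingDiskMaps R) κ (0 : X ⟶ 0)) 0 := ⟨(isZero_zero _).eq_of_tgt _ _⟩
  refine ⟨(diskHomEquiv sq.lift).hom, fun x ↦ ?_⟩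
  have h := (diskMap_comp_eq_iff _ _ _).1 sq.fac_left
  rw [Equiv.apply_symm_apply] at h
  exact congr($h x)

end SmallObjectArgument

/-! ### Contractibility of complexes of injectives -/

section WellOrderedChains

open Submodule

/-- A lifting problem on the span of a well-ordered family can be solved if solutions extend from
`span (f '' Iio a)` to `span (f '' Iic a)` for all `a`. -/
lemma exists_lift_of_forall_extend {R : Type*} [Ring R] {N P Q : Type*} [AddCommGroup N]
    [Module R N] [AddCommGroup P] [Module R P] [AddCommGroup Q] [Module R Q] {α : Type*}
    [LinearOrder α] [WellFoundedLT α] (f : α → N) (d : P →ₗ[R] Q) (g : N →ₗ.[R] Q)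
    (hext : ∀ (a : α) (p : N →ₗ.[R] P), p.domain = span R (f '' Set.Iio a) →
      d.compPMap p ≤ g → ∃ p' : N →ₗ.[R] P, p'.domain = span R (f '' Set.Iic a) ∧
        p ≤ p' ∧ d.compPMap p' ≤ g) :
    ∃ p : N →ₗ.[R] P, p.domain = span R (Set.range f) ∧ d.compPMap p ≤ g := by
  let s : Set (N →ₗ.[R] P) :=
    {p | (∃ L : Set α, IsLowerSet L ∧ p.domain = span R (f '' L)) ∧ d.compPMap p ≤ g}
  obtain ⟨p, ⟨⟨L, hL, hpL⟩, hp⟩, hmax⟩ := zorn_le₀ s fun c hcs hc ↦ by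
    rcases c.eq_empty_or_nonempty with rfl | hne
    · refine ⟨⊥, ⟨⟨∅, isLowerSet_empty, ?_⟩, ?_, ?_⟩, by simp⟩
      · rw [Set.image_empty, span_empty]
        rfl
      · rintro x hx
        rw [(mem_bot R).1 hx]
        exact zero_mem _
      · rintro ⟨x, hx⟩ y hxy
        obtain rfl : x = 0 := (mem_bot R).1 hx
        obtain rfl : y = 0 := Subtype.ext hxy.symm
        exact (d.compPMap ⊥).map_zero.trans g.map_zero.symm
    · refine ⟨LinearPMap.sSup c hc.directedOn, ⟨⟨?_, ?_⟩, fun p hp ↦ LinearPMap.le_sSup _ hp⟩⟩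
      · choose L hL hpL using fun p : c ↦ (hcs p.2).1
        refine ⟨⋃ p, L p, isLowerSet_iUnion hL, ?_⟩
        rw [LinearPMap.domain_sSup, Set.image_iUnion, span_iUnion, sSup_image, iSup_subtype']
        exact iSup_congr hpL
      · refine ⟨fun x hx ↦ ?_, ?_⟩
        · obtain ⟨p, hp, hx⟩ := (LinearPMap.mem_domain_sSup_iff hne hc.directedOn).1 hx
          exact (hcs hp).2.1 hx
        · rintro ⟨x, hx⟩ y hxy
          obtain ⟨p, hp, hx'⟩ := (LinearPMap.mem_domain_sSup_iff hne hc.directedOn).1 hx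
          rw [← (hcs hp).2.2 (x := ⟨x, hx'⟩) (y := y) hxy]
          exact congr_arg d (LinearPMap.sSup_apply _ hp ⟨x, hx'⟩)
  refine ⟨p, ?_, hp⟩
  refine le_antisymm (hpL.trans_le (span_mono (Set.image_subset_range _ _))) (span_le.2 ?_)
  by_contra hne
  obtain ⟨_, ⟨b, rfl⟩, hb⟩ := Set.not_subset.1 hne
  -- the least index whose generator is not in the domain
  obtain ⟨a, ha, hamin⟩ := WellFounded.has_min (α := α) wellFounded_lt
    {a | f a ∉ p.domain} ⟨b, hb⟩
  have hpa : p.domain = span R (f '' Set.Iio a) := by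
    refine le_antisymm (hpL.trans_le (span_mono (Set.image_mono fun x hx ↦ ?_))) (span_le.2 ?_)
    · by_contra hxa
      exact ha (hpL ▸ subset_span ⟨a, hL (not_lt.1 hxa) hx, rfl⟩)
    · rintro _ ⟨x, hx, rfl⟩
      by_contra hx'
      exact hamin x hx' hx
  obtain ⟨p', hp', hle, hd⟩ := hext a p hpa hp
  exact ha ((hmax ⟨⟨_, isLowerSet_Iic a, hp'⟩, hd⟩ hle).1
    (hp' ▸ subset_span ⟨a, Set.mem_Iic.2 le_rfl, rfl⟩))

end WellOrderedChains

section DegreewiseInjective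

variable {R : Type u} [Ring R] {Y : ChainComplex (ModuleCat.{u} R) ℤ}

/-- If `Hom(A, Y)` and `Hom(B, Y)` are exact and `Y` is degreewise injective, solutions of lifting
problems extend from `A` to `B`. -/
lemma IsHomExact.exists_extension (hY : IsDegreewiseInjective Y) {A B : ModuleCat.{u} R}
    (hA : IsHomExact A Y) (hB : IsHomExact B Y) (m : A ⟶ B) [Mono m] {i j : ℤ} (hi : j + 1 = i)
    {k : ℤ} (hj : k + 1 = j) (g : B ⟶ Y.X j) (hg : g ≫ Y.d j k = 0) (h : A ⟶ Y.X i)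
    (hh : h ≫ Y.d i j = m ≫ g) :
    ∃ h' : B ⟶ Y.X i, m ≫ h' = h ∧ h' ≫ Y.d i j = g := by
  have := hY (i + 1)
  obtain ⟨l, rfl⟩ := hB i j k hi hj g hg
  obtain ⟨t, ht⟩ := hA (i + 1) i j rfl hi (m ≫ l - h) (by simp [hh])
  refine ⟨l - Injective.factorThru t m ≫ Y.d (i + 1) i, ?_, by simp⟩
  rw [Preadditive.comp_sub, Injective.comp_factorThru_assoc, ht, sub_sub_cancel]

/-- Exactness of `Hom(I, Y)` for a left ideal `I`, by induction on the number of generators.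
Finitely generated left ideals are finitely presented; a larger one is the union of a
well-ordered chain of left ideals with fewer generators, along which solutions extend. -/
lemma isHomExact_span (hR : IsLeftCoherent R) (hY : IsDegreewiseInjective Y)
    (hY' : IsFPHomExact Y) (κ : Cardinal.{u}) (f : κ.ord.ToType → R) :
    IsHomExact (ModuleCat.of R (Ideal.span (Set.range f))) Y := by
  induction κ using WellFoundedLT.induction with
  | ind κ ih =>
  have ih' (s : Set κ.ord.ToType) (hs : Cardinal.mk s < κ) :
      IsHomExact (ModuleCat.of R (Ideal.span (f '' s))) Y := by
    obtain ⟨e⟩ : Nonempty ((Cardinal.mk s).ord.ToType ≃ s) := Cardinal.eq.1 (by simp)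
    have := ih _ hs (fun x ↦ f (e x))
    have hr : Set.range (fun x ↦ f (e x)) = f '' s := by
      rw [Set.range_comp' f, Set.range_comp' Subtype.val, e.range_eq_univ, Set.image_univ,
        Subtype.range_coe]
    rwa [hr] at this
  rcases lt_or_ge κ Cardinal.aleph0 with hκ | hκ
  · have : Finite κ.ord.ToType := by
      rw [← Cardinal.lt_aleph0_iff_finite]
      simpa using hκ
    exact hY' _ (hR _ (Submodule.fg_span (Set.finite_range f)))
  · rintro i j k hi hj g hg
    obtain ⟨⟨D, p⟩, hp, hpg⟩ := exists_lift_of_forall_extend f (Y.d i j).hom ⟨_, g.hom⟩ (by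
      rintro a ⟨D, p⟩ hp hpg
      obtain rfl : D = _ := hp
      have h₁ : Cardinal.mk (Set.Iio a) < κ := by simpa using Cardinal.mk_Iio_lt a
      -- `κ` is infinite here, so one more generator does no harm
      have h₂ : Cardinal.mk (Set.Iic a) < κ := by
        rw [← Set.Iio_insert]
        exact Cardinal.mk_insert_le.trans_lt
          (Cardinal.add_lt_of_lt hκ h₁ (Cardinal.one_lt_aleph0.trans_le hκ))
      let m : ModuleCat.of R (Ideal.span (f '' Set.Iio a)) ⟶
          ModuleCat.of R (Ideal.span (f '' Set.Iic a)) :=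
        ModuleCat.ofHom (Submodule.inclusion
          (Submodule.span_mono (Set.image_mono Set.Iio_subset_Iic_self)))
      let l : ModuleCat.of R (Ideal.span (f '' Set.Iic a)) ⟶
          ModuleCat.of R (Ideal.span (Set.range f)) :=
        ModuleCat.ofHom (Submodule.inclusion
          (Submodule.span_mono (Set.image_subset_range _ _)))
      have : Mono m := (ModuleCat.mono_iff_injective _).2 (Submodule.inclusion_injective
        (Submodule.span_mono (Set.image_mono Set.Iio_subset_Iic_self)))
      obtain ⟨p', hp', hd⟩ := IsHomExact.exists_extension hY (ih' _ h₁) (ih' _ h₂) m hi hj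
        (l ≫ g) (by rw [Category.assoc, hg, comp_zero]) (ModuleCat.ofHom p) (by
          ext x
          exact hpg.2 (x := x) (y := l (m x)) rfl)
      refine ⟨⟨_, p'.hom⟩, rfl, ⟨Submodule.span_mono (Set.image_mono Set.Iio_subset_Iic_self),
        ?_⟩, Submodule.span_mono (Set.image_subset_range _ _), ?_⟩
      · rintro x y hxy
        obtain rfl : m x = y := Subtype.ext hxy
        exact congr($hp' x).symm
      · rintro x y hxy
        obtain rfl : l x = y := Subtype.ext hxy
        exact congr($hd x))
    obtain rfl : D = _ := hp
    refine ⟨ModuleCat.ofHom p, ?_⟩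
    ext x
    exact hpg.2 (x := x) (y := x) rfl

lemma isHomExact_ideal (hR : IsLeftCoherent R) (hY : IsDegreewiseInjective Y)
    (hY' : IsFPHomExact Y) (I : Ideal R) : IsHomExact (ModuleCat.of R I) Y := by
  obtain ⟨e⟩ : Nonempty ((Cardinal.mk I).ord.ToType ≃ I) := Cardinal.eq.1 (by simp)
  have h := isHomExact_span hR hY hY' _ (fun x ↦ (e x : R))
  have hI : Ideal.span (Set.range fun x ↦ (e x : R)) = I := by
    rw [Set.range_comp' Subtype.val, e.range_eq_univ, Set.image_univ, Subtype.range_coe,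
      Ideal.span_eq]
  rwa [hI] at h

/-- The cycle modules are injective by Baer's criterion: a map from a left ideal to the cycles lifts
along the differential, and the lift extends to `R`. -/
lemma injective_cycles (hR : IsLeftCoherent R) (hY : IsDegreewiseInjective Y)
    (hY' : IsFPHomExact Y) (n : ℤ) : Injective (Y.cycles n) := by
  have hB : Module.Baer R (Y.cycles n) := by
    intro I φ
    obtain ⟨ψ, hψ⟩ := isHomExact_ideal hR hY hY' I (n + 1) n (n - 1) rfl (by simp)
      (ModuleCat.ofHom φ ≫ Y.iCycles n) (by simp)
    have hE : Module.Injective R (Y.X (n + 1)) :=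
      (Module.injective_iff_injective_object R _).2 (hY (n + 1))
    obtain ⟨χ, hχ⟩ := Module.Baer.of_injective hE I ψ.hom
    refine ⟨(ModuleCat.ofHom χ ≫ Y.toCycles (n + 1) n).hom, fun x hx ↦ ?_⟩
    refine (ModuleCat.mono_iff_injective (Y.iCycles n)).1 inferInstance ?_
    have h := congr($hψ ⟨x, hx⟩)
    rw [← Y.toCycles_i (n + 1) n] at h
    refine Eq.trans ?_ h
    exact congr(Y.iCycles n (Y.toCycles (n + 1) n $(hχ x hx)))
  exact (Module.injective_iff_injective_object R (Y.cycles n)).1 hB.injective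

/-- The cycle modules are injective, so `Y` splits degreewise into cycles. -/
lemma isHomExact_of_isFPHomExact (hR : IsLeftCoherent R) (hY : IsDegreewiseInjective Y)
    (hY' : IsFPHomExact Y) (A : ModuleCat.{u} R) : IsHomExact A Y := by
  rintro i j k rfl rfl g hg
  have := injective_cycles hR hY hY' (k + 1 + 1)
  have hS := ((hY' (ModuleCat.of R R)
    (Module.finitePresentation_of_projective R R)).acyclic).cycles_shortExact (k + 1)
  have : Injective (ShortComplex.mk (Y.iCycles (k + 1 + 1)) (Y.toCycles (k + 1 + 1) (k + 1))
      (by simp [← cancel_mono (Y.iCycles (k + 1))])).X₁ := this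
  have s := hS.splittingOfInjective
  refine ⟨Y.liftCycles g k (by simp) hg ≫ s.s, ?_⟩
  have h := s.s_g
  dsimp at h
  simpa using congr(Y.liftCycles g k (by simp) hg ≫ $h ≫ Y.iCycles (k + 1))

/-- If every `Hom(A, Y)` is exact, then `Y` is contractible. -/
lemma nonempty_contraction_of_isHomExact (hY : ∀ A, IsHomExact A Y) :
    Nonempty (Homotopy (𝟙 Y) 0) := by
  have h (i j : ℤ) : ∃ σ : Y.cycles i ⟶ Y.X j,
      (i + 1 = j → σ ≫ Y.d j i = Y.iCycles i) ∧ (i + 1 ≠ j → σ = 0) := by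
    by_cases hij : i + 1 = j
    · obtain ⟨σ, hσ⟩ := hY (Y.cycles i) j i (i - 1) hij (by simp) (Y.iCycles i) (by simp)
      exact ⟨σ, fun _ ↦ hσ, fun h ↦ (h hij).elim⟩
    · exact ⟨0, fun h ↦ (hij h).elim, fun _ ↦ rfl⟩
  choose σ hσ hσ' using h
  -- the projection onto the cycles along the complement given by the sections `σ`
  let r (i : ℤ) : Y.X i ⟶ Y.cycles i :=
    Y.liftCycles (𝟙 _ - Y.toCycles i (i - 1) ≫ σ (i - 1) i) (i - 1) (by simp) (by
      simp [hσ (i - 1) i (by simp)])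
  have hr (i : ℤ) : r i ≫ Y.iCycles i = 𝟙 _ - Y.toCycles i (i - 1) ≫ σ (i - 1) i := by
    simp [r]
  have hdr (i : ℤ) : Y.d i (i - 1) ≫ r (i - 1) = Y.toCycles i (i - 1) := by
    rw [← cancel_mono (Y.iCycles (i - 1)), Category.assoc, hr]
    simp
  refine ⟨{ hom := fun i j ↦ r i ≫ σ i j, zero := fun i j hij ↦ ?_, comm := fun i ↦ ?_ }⟩
  · rw [hσ' i j hij, comp_zero]
  · rw [dNext_eq _ (show (ComplexShape.down ℤ).Rel i (i - 1) by simp),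
      prevD_eq _ (show (ComplexShape.down ℤ).Rel (i + 1) i by simp),
      Category.assoc, hσ i (i + 1) rfl, hr, reassoc_of% hdr i]
    simp

/-- Over a left coherent ring, a complex of injectives with `Hom(F, Y)` exact for all finitely
presented `F` is contractible. -/
theorem IsLeftCoherent.nonempty_contraction (hR : IsLeftCoherent R) (hY : IsDegreewiseInjective Y)
    (hY' : IsFPHomExact Y) : Nonempty (Homotopy (𝟙 Y) 0) :=
  nonempty_contraction_of_isHomExact (isHomExact_of_isFPHomExact hR hY hY')

end DegreewiseInjective

/-! ### Path objects and coacyclic complexes -/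

section PathObject

variable {R : Type u} [Ring R]

/-- The path object of `Y`, with `Y.X n ⊞ Y.X (n + 1)` in degree `n` and differential
`(x, y) ↦ (d x, x - d y)`. Lifts of `f : X ⟶ Y` to it are homotopies from `f` to `0`. -/
noncomputable def pathObject (Y : ChainComplex (ModuleCat.{u} R) ℤ) :
    ChainComplex (ModuleCat.{u} R) ℤ :=
  ChainComplex.of (fun n ↦ Y.X n ⊞ Y.X (n + 1))
    (fun n ↦ biprod.lift (biprod.fst ≫ Y.d (n + 1) n)
      (biprod.fst - biprod.snd ≫ Y.d (n + 1 + 1) (n + 1)))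
    (fun n ↦ by apply biprod.hom_ext <;> simp)

namespace pathObject

variable {X Y : ChainComplex (ModuleCat.{u} R) ℤ} {A : ModuleCat.{u} R} {n : ℤ}

/-- The first component of the path object. -/
noncomputable def fst (Y : ChainComplex (ModuleCat.{u} R) ℤ) (n : ℤ) :
    (pathObject Y).X n ⟶ Y.X n :=
  biprod.fst (X := Y.X n) (Y := Y.X (n + 1))

/-- The second component of the path object. -/
noncomputable def snd (Y : ChainComplex (ModuleCat.{u} R) ℤ) (n : ℤ) :
    (pathObject Y).X n ⟶ Y.X (n + 1) :=
  biprod.snd (X := Y.X n) (Y := Y.X (n + 1))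

/-- The morphism to the path object with given components. -/
noncomputable def liftX (a : A ⟶ Y.X n) (b : A ⟶ Y.X (n + 1)) : A ⟶ (pathObject Y).X n :=
  biprod.lift a b

@[simp]
lemma liftX_fst (a : A ⟶ Y.X n) (b : A ⟶ Y.X (n + 1)) : liftX a b ≫ fst Y n = a :=
  biprod.lift_fst _ _

@[simp]
lemma liftX_snd (a : A ⟶ Y.X n) (b : A ⟶ Y.X (n + 1)) : liftX a b ≫ snd Y n = b :=
  biprod.lift_snd _ _

lemma hom_ext {f g : A ⟶ (pathObject Y).X n} (h₁ : f ≫ fst Y n = g ≫ fst Y n)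
    (h₂ : f ≫ snd Y n = g ≫ snd Y n) : f = g :=
  biprod.hom_ext (X := Y.X n) (Y := Y.X (n + 1)) _ _ h₁ h₂

lemma d_eq (n : ℤ) : (pathObject Y).d (n + 1) n =
    liftX (fst Y (n + 1) ≫ Y.d (n + 1) n)
      (fst Y (n + 1) - snd Y (n + 1) ≫ Y.d (n + 1 + 1) (n + 1)) :=
  (dif_pos rfl).trans (Category.id_comp _)

/-- The projection from the path object. -/
noncomputable def π (Y : ChainComplex (ModuleCat.{u} R) ℤ) : pathObject Y ⟶ Y :=
  ChainComplex.ofHom (fst Y) fun n ↦ by rw [d_eq, liftX_fst]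

/-- The lift to the path object given by a null homotopy. -/
noncomputable def lift {f : X ⟶ Y} (h : Homotopy f 0) : X ⟶ pathObject Y :=
  ChainComplex.ofHom (fun n ↦ liftX (f.f n) (h.hom n (n + 1))) fun n ↦ by
    have hn := h.comm (n + 1)
    rw [dNext_eq _ (show (ComplexShape.down ℤ).Rel (n + 1) n from rfl),
      prevD_eq _ (show (ComplexShape.down ℤ).Rel (n + 1 + 1) (n + 1) from rfl)] at hn
    rw [d_eq]
    apply hom_ext
    · simp [reassoc_of% liftX_fst]
    · simp [hn, reassoc_of% liftX_snd]

lemma lift_π {f : X ⟶ Y} (h : Homotopy f 0) : lift h ≫ π Y = f := by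
  ext1 n
  exact liftX_fst _ _

/-- A section of the projection from the path object contracts the complex. -/
lemma nonempty_contraction_of_section (t : Y ⟶ pathObject Y) (ht : t ≫ π Y = 𝟙 Y) :
    Nonempty (Homotopy (𝟙 Y) 0) := by
  have hπ (n : ℤ) : (π Y).f (n + 1) =
      (pathObject Y).d (n + 1) n ≫ snd Y n + snd Y (n + 1) ≫ Y.d (n + 1 + 1) (n + 1) := by
    rw [d_eq, liftX_snd, sub_add_cancel]
    rfl
  refine ⟨{ hom := fun i j ↦ if h : i + 1 = j then t.f i ≫ snd Y i ≫ eqToHom (by rw [h]) else 0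
            zero := fun i j hij ↦ dif_neg hij
            comm := fun i ↦ ?_ }⟩
  obtain ⟨n, rfl⟩ : ∃ n, i = n + 1 := ⟨i - 1, by simp⟩
  rw [dNext_eq _ (show (ComplexShape.down ℤ).Rel (n + 1) n from rfl),
    prevD_eq _ (show (ComplexShape.down ℤ).Rel (n + 1 + 1) (n + 1) from rfl), ← ht,
    HomologicalComplex.comp_f, hπ]
  simp

/-- The projection from the path object of a complex of injectives has the right lifting property
with respect to disks on monomorphisms. -/
lemma generatingDiskMaps_rlp_π (hY : IsDegreewiseInjective Y) :
    (generatingDiskMaps R).rlp (π Y) := by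
  refine generatingDiskMaps_rlp_of_degreewise _ fun n A B i (hi : Mono i) ↦ ⟨fun {a b} sq ↦ ?_⟩
  have := hY (n + 1)
  have hw : a ≫ fst Y n = i ≫ b := sq.w
  have h : i ≫ liftX b (Injective.factorThru (a ≫ snd Y n) i) = a := by
    apply hom_ext <;> simp [hw]
  exact ⟨⟨⟨liftX b (Injective.factorThru (a ≫ snd Y n) i), h, liftX_fst _ _⟩⟩⟩

end pathObject

end PathObject

section Lifting

variable {R : Type u} [Ring R] {X Y : ChainComplex (ModuleCat.{u} R) ℤ}

open ZeroObject in
/-- A morphism to a complex of injectives extends along morphisms with the left lifting property. -/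
lemma exists_extension_of_llp {I : ChainComplex (ModuleCat.{u} R) ℤ} {i : X ⟶ Y}
    (hi : (generatingDiskMaps R).rlp.llp i) (hI : IsDegreewiseInjective I) (f : X ⟶ I) :
    ∃ f' : Y ⟶ I, i ≫ f' = f := by
  have := hi (0 : I ⟶ 0) <| generatingDiskMaps_rlp_of_degreewise _ fun n A B m (hm : Mono m) ↦
    ⟨fun {a b} _ ↦ by
      have := hI n
      exact ⟨⟨⟨Injective.factorThru a m, by simp,
        ((HomologicalComplex.eval _ _ n).map_isZero (isZero_zero _)).eq_of_tgt _ _⟩⟩⟩⟩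
  have sq : CommSq f i (0 : I ⟶ 0) 0 := ⟨by simp⟩
  exact ⟨sq.lift, sq.fac_left⟩

/-- A complex of injectives is contractible if it receives a null homotopic morphism with the left
lifting property: lifting the identity against the path object, along the null homotopy, gives a
section of the projection. -/
lemma nonempty_contraction_of_llp {i : X ⟶ Y} (hi : (generatingDiskMaps R).rlp.llp i)
    (hY : IsDegreewiseInjective Y) (h : Homotopy i 0) : Nonempty (Homotopy (𝟙 Y) 0) := by
  have := hi _ (pathObject.generatingDiskMaps_rlp_π hY)
  have sq : CommSq (pathObject.lift h) i (pathObject.π Y) (𝟙 Y) :=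
    ⟨by rw [pathObject.lift_π, Category.comp_id]⟩
  exact pathObject.nonempty_contraction_of_section sq.lift sq.fac_right

/-- If `Y` is contractible, then every `Hom(F, Y)` is exact. -/
lemma isHomExact_of_contraction (h : Homotopy (𝟙 Y) 0) (F : ModuleCat.{u} R) :
    IsHomExact F Y := by
  rintro i j k rfl rfl g hg
  refine ⟨g ≫ h.hom (k + 1) (k + 1 + 1), ?_⟩
  have hk := h.comm (k + 1)
  rw [dNext_eq _ (show (ComplexShape.down ℤ).Rel (k + 1) k from rfl),
    prevD_eq _ (show (ComplexShape.down ℤ).Rel (k + 1 + 1) (k + 1) from rfl)] at hk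
  simpa [reassoc_of% hg] using congr(g ≫ $hk).symm

end Lifting

section Coacyclic

variable {R : Type u} [Ring R] {X Y : ChainComplex (ModuleCat.{u} R) ℤ}

/-- Exactness of the complexes `Hom(F, X)` passes to the target of an FP-acyclic extension. -/
lemma IsFPAcyclicExtension.isFPHomExact {f : X ⟶ Y} (hf : IsFPAcyclicExtension f) [Mono f]
    (hX : IsFPHomExact X) : IsFPHomExact Y := by
  rintro F hF i j k hi hj g hg
  obtain ⟨l, rfl⟩ : ∃ l, k = l + 1 := ⟨k - 1, by simp⟩
  obtain ⟨h, x, rfl⟩ := hf.exists_eq_add F hF i j (l + 1) hi hj g 0 (by simp [hg])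
  obtain ⟨y, rfl⟩ := hX F hF i j (l + 1) hi hj x (by
    rw [← cancel_mono (f.f (l + 1))]
    simpa using hg)
  exact ⟨h + y ≫ f.f i, by simp⟩

/-- Exactness of the complexes `Hom(F, Y)` passes to the source of an FP-acyclic extension: a
cycle of `X` bounds some `y` in `Y`, and `y` differs from an element of `X` by a boundary. -/
lemma IsFPAcyclicExtension.isFPHomExact_of_target {f : X ⟶ Y} (hf : IsFPAcyclicExtension f)
    [Mono f] (hY : IsFPHomExact Y) : IsFPHomExact X := by
  rintro F hF i j k hi hj g hg
  obtain ⟨y, hy⟩ := hY F hF i j k hi hj (g ≫ f.f j) (by simp [reassoc_of% hg])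
  obtain ⟨h, x, rfl⟩ := hf.exists_eq_add F hF (i + 1) i j rfl hi y g hy
  refine ⟨x, ?_⟩
  rw [← cancel_mono (f.f j), ← hy]
  simp

/-- Over a left coherent ring, a degreewise FP-injective complex is coacyclic exactly if `Hom(F, -)`
is exact on it for all finitely presented `F`. Both properties are compared with the contractibility
of a complex of injectives in which it embeds by an FP-acyclic extension. -/
theorem IsLeftCoherent.isCoacyclic_iff (hR : IsLeftCoherent R) (hX : IsDegreewiseFPInjective X) :
    IsCoacyclic X ↔ IsFPHomExact X := by
  obtain ⟨Y, i, _, hY, hi, hi'⟩ := hR.exists_isFPAcyclicExtension X hX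
  constructor
  · intro h
    obtain ⟨h⟩ := h Y hY i
    obtain ⟨h⟩ := nonempty_contraction_of_llp hi' hY h
    exact hi.isFPHomExact_of_target fun F _ ↦ isHomExact_of_contraction h F
  · intro h I hI f
    obtain ⟨h⟩ := hR.nonempty_contraction hY (hi.isFPHomExact h)
    obtain ⟨f', rfl⟩ := exists_extension_of_llp hi' hI f
    exact ⟨(Homotopy.ofEq (by simp)).trans (((h.compRight f').compLeft i).trans
      (Homotopy.ofEq (by simp)))⟩

end Coacyclic

theorem mainTheorem8 (R : Type u) [Ring R] (hR : IsLeftCoherent R)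
    (X : ChainComplex (ModuleCat.{u} R) ℤ) :
    (IsExactWithFPInjectiveCycles X ↔ IsCoacyclic X ∧ IsDegreewiseFPInjective X) ∧
    (IsExactWithFPInjectiveCycles X ↔ IsPureExact X ∧ IsDegreewiseFPInjective X) := by
  rw [isExactWithFPInjectiveCycles_iff, isPureExact_iff]
  exact ⟨and_congr_left fun hX ↦ (hR.isCoacyclic_iff hX).symm, Iff.rfl⟩
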